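/- Let $p=(p_i)_{i\ge 1}$ be a sequence in $[0,1]$, and let $B_1,B_2,\dots$ be independent Bernoulli random variables with $\Pr[B_i=1]=p_i$ (success) and $\Pr[B_i=0]=1-p_i$ (failure). For each integer $x\ge 1$ let $$U_p(x)=\inf\Big\{k\in\mathbb N:\ \sum_{i=1}^k(1-B_i)=x\Big\}-x,$$ the number of successes before the $x$-th failure (with $\inf\emptyset=\infty$), and set $U_p(0)=1$. For $n\ge 1$ put $$\overline p_n=\frac1n\sum_{i=1}^n p_i,\qquad A_n=\frac1n\sum_{i=1}^n p_i(1-p_i).$$ Suppose that $\lim_{n\to\infty}\overline p_n=\frac12$, that the limit $A=\lim_{n\to\infty}A_n$ exists and is strictly positive, and that there is a constant $K$ such that $|\overline p_n-\frac12|\le \frac Kn$ and $|A_n-A|\le\frac Kn$ for all $n\ge 1$. Then for every $x\ge 0$ the variable $U_p(x)$ is almost surely finite and $\mathbb E[(U_p(x)-x)^2]<\infty$; the limit $$\lim_{x\to\infty}\frac1x\,\mathbb E\big[(U_p(x)-x)^2\big]=8A$$ exists; and moreover there are constants $C$ and $x_0$, depending only on $p$, such that for all integers $x\ge x_0$ $$\Big|\frac1x\,\mathbb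 E\big[(U_p(x)-x)^2\big]-8A\Big|\le C\,\frac{\log^4 x}{\sqrt x}.$$ -/

import Mathlib

open MeasureTheory ProbabilityTheory Filter Topology

noncomputable section

namespace CookieEnv

/-- A cookie environment: a sequence of probabilities in `[0,1]`.
Indices start at `0`, so `p i` is the probability `p_{i+1}` of the `(i+1)`-st trial. -/
abbrev Env : Type := ℕ → unitInterval

/-- The law of a sequence of independent trials in which the trial with index `i` is a success
(`true`) with probability `p i` and a failure (`false`) with probability `1 - p i`. -/
def trialLaw (p : Env) : Measure (ℕ → Bool) :=
  Measure.infinitePi fun i => bernoulliMeasure true false (p i)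

/-- Number of failures among the first `k` trials, `∑_{i=1}^k (1 - B_i)`. -/
def failures (k : ℕ) (ω : ℕ → Bool) : ℕ :=
  ∑ i ∈ Finset.range k, (1 - (ω i).toNat)

/-- `U(x) = inf {k : ∑_{i=1}^k (1 - B_i) = x} - x` for `x > 0`, with `U(0) = 1`.
The infimum is taken in `ℕ∞`, so that `U(x) = ⊤` if there are fewer than `x` failures. -/
def U (x : ℕ) (ω : ℕ → Bool) : ℕ∞ :=
  if x = 0 then 1 else (⨅ (k : ℕ) (_ : failures k ω = x), (k : ℕ∞)) - (x : ℕ∞)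

/-- The squared deviation `(U(x) - x)^2`, meaningful where `U(x)` is finite. -/
def sqDev (x : ℕ) (ω : ℕ → Bool) : ℝ :=
  (((U x ω).toNat : ℝ) - (x : ℝ)) ^ 2

/-- The running average `(1/n) ∑_{i=1}^n p_i`. -/
def pBar (p : Env) (n : ℕ) : ℝ :=
  (1 / (n : ℝ)) * ∑ i ∈ Finset.range n, (p i : ℝ)

/-- The running average `(1/n) ∑_{i=1}^n p_i (1 - p_i)`. -/
def avgVar (p : Env) (n : ℕ) : ℝ :=
  (1 / (n : ℝ)) * ∑ i ∈ Finset.range n, (p i : ℝ) * (1 - (p i : ℝ))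

/-- The normalized second moment `(1/x) E[(U_p(x) - x)^2]`. -/
def nu (p : Env) (x : ℕ) : ℝ :=
  (1 / (x : ℝ)) * ∫ ω, sqDev x ω ∂(trialLaw p)

end CookieEnv

end

namespace CookieEnv

/-! Let T be the trial of the x-th failure, so U(x) - x = T - 2x. The centred walk M, with
increments 2(B_k - p_k), satisfies M_T = T - 2x - d_T, where d is `drift`; the rate hypothesis
bounds |d| by a constant. Hence U(x) - x differs from M_T by O(1). Optional stopping for M and for
its compensated square gives E T = 2x + O(1) and E M_T^2 = 4 E[`varSum` at T] = 4A E T + O(1) = 8Ax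
+ O(1) (`integral_stopped_sq`, `abs_integral_mart_hit_sq_sub_le`). Replacing M_T by M_T + d_T costs
a cross term of order √x (`abs_integral_sqDev_sub_le`). After division by x the error is O(1/√x),
stronger than the stated rate. Optional stopping is proved at the bounded time min(T, n), where
every variable depends on finitely many trials. Fatou's lemma and dominated convergence then let n
tend to infinity. -/

instance (p : Env) : IsProbabilityMeasure (trialLaw p) := by
  unfold trialLaw; infer_instance

/-! ### Functions of finitely many trials -/

section FiniteDependence

variable {n : ℕ} {Y : (ℕ → Bool) → ℝ}

lemma exists_eq_comp_restrict (hY : DependsOn Y (Finset.range n)) :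
    ∃ f : (Finset.range n → Bool) → ℝ, Y = fun ω => f (fun i => ω i) :=
  dependsOn_iff_exists_comp.1 hY

lemma measurable_of_dependsOn (hY : DependsOn Y (Finset.range n)) : Measurable Y := by
  obtain ⟨f, rfl⟩ := exists_eq_comp_restrict hY
  exact (measurable_of_finite f).comp (by fun_prop)

lemma integrable_of_dependsOn (p : Env) (hY : DependsOn Y (Finset.range n)) :
    Integrable Y (trialLaw p) := by
  have hm := measurable_of_dependsOn hY
  obtain ⟨f, rfl⟩ := exists_eq_comp_restrict hY
  refine Integrable.of_bound hm.aestronglyMeasurable (∑ a, ‖f a‖) (ae_of_all _ fun ω => ?_)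
  exact Finset.single_le_sum (f := fun a => ‖f a‖) (fun a _ => norm_nonneg _) (Finset.mem_univ _)

lemma integral_eval (p : Env) (n : ℕ) (g : Bool → ℝ) :
    ∫ ω, g (ω n) ∂(trialLaw p) = p n * g true + (1 - p n) * g false := by
  have h := Measure.infinitePi_map_eval (fun i => bernoulliMeasure true false (p i)) n
  rw [trialLaw, ← integral_map (φ := fun ω : ℕ → Bool => ω n) (f := g)
    (measurable_pi_apply n).aemeasurable
    (measurable_of_finite g).aestronglyMeasurable]
  erw [h]
  rw [integral_bernoulliMeasure]
  simp

/-- Independence enters here: trial n is independent of the trials before it. Both martingale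
identities rest on this factorization. -/
lemma integral_mul_eval (p : Env) (hY : DependsOn Y (Finset.range n)) (g : Bool → ℝ) :
    ∫ ω, Y ω * g (ω n) ∂(trialLaw p) =
      (∫ ω, Y ω ∂(trialLaw p)) * (p n * g true + (1 - p n) * g false) := by
  rw [← integral_eval]
  have hm := measurable_of_dependsOn hY
  obtain ⟨f, rfl⟩ := exists_eq_comp_restrict hY
  have hind : iIndepFun (fun (i : ℕ) (ω : ℕ → Bool) => ω i) (trialLaw p) :=
    iIndepFun_infinitePi (P := fun i => bernoulliMeasure true false (p i))
      (X := fun _ b => b) (fun _ => measurable_id)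
  have h := hind.indepFun_finset (Finset.range n) {n} (by simp) (fun i => by fun_prop)
  have h' := h.comp (φ := f) (ψ := fun b : ({n} : Finset ℕ) → Bool => g (b ⟨n, by simp⟩))
    (measurable_of_finite _) (measurable_of_finite _)
  exact h'.integral_fun_mul_eq_mul_integral hm.aestronglyMeasurable
    ((measurable_of_finite g).comp (measurable_pi_apply n)).aestronglyMeasurable

end FiniteDependence

/-! ### The centred walk stopped at the x-th failure -/

section Stopping

/-- Indicator of the event that fewer than `x` failures occurred in the first `k` trials. -/
def alive (x k : ℕ) (ω : ℕ → Bool) : ℕ := if failures k ω < x then 1 else 0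

/-- The number of trials up to the `x`-th failure, truncated at `n`. -/
def steps (x n : ℕ) (ω : ℕ → Bool) : ℕ := ∑ k ∈ Finset.range n, alive x k ω

/-- The centred increment `2 (B_k - p_k)`. -/
noncomputable def noise (p : Env) (k : ℕ) (ω : ℕ → Bool) : ℝ := 2 * (((ω k).toNat : ℝ) - p k)

/-- The centred walk. -/
noncomputable def mart (p : Env) (n : ℕ) (ω : ℕ → Bool) : ℝ := ∑ k ∈ Finset.range n, noise p k ω

/-- The mean of successes minus failures in the first `n` trials. -/
noncomputable def drift (p : Env) (n : ℕ) : ℝ := ∑ k ∈ Finset.range n, (2 * (p k : ℝ) - 1)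

/-- The variance of the number of successes in the first `n` trials. -/
noncomputable def varSum (p : Env) (n : ℕ) : ℝ := ∑ k ∈ Finset.range n, (p k : ℝ) * (1 - p k)

lemma failures_succ (k : ℕ) (ω : ℕ → Bool) :
    failures (k + 1) ω = failures k ω + (1 - (ω k).toNat) := by
  simp [failures, Finset.sum_range_succ]

lemma failures_mono (ω : ℕ → Bool) : Monotone (failures · ω) :=
  monotone_nat_of_le_succ fun k => by simp [failures_succ]

lemma mart_eq (p : Env) (n : ℕ) (ω : ℕ → Bool) :
    mart p n ω = n - 2 * failures n ω - drift p n := by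
  induction n with
  | zero => simp [mart, failures, drift]
  | succ n ih =>
    rw [mart, Finset.sum_range_succ, ← mart, ih, failures_succ, drift, drift,
      Finset.sum_range_succ, noise]
    cases ω n <;> simp <;> ring

lemma steps_succ (x n : ℕ) (ω : ℕ → Bool) : steps x (n + 1) ω = steps x n ω + alive x n ω := by
  simp [steps, Finset.sum_range_succ]

lemma steps_eq_self {x n : ℕ} {ω : ℕ → Bool} (h : ∀ k < n, failures k ω < x) :
    steps x n ω = n := by
  rw [steps, Finset.sum_congr rfl (g := fun _ => 1) fun k hk => ?_]
  · simp
  · exact if_pos (h k (Finset.mem_range.1 hk))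

lemma steps_eq_self_of_lt {x n : ℕ} {ω : ℕ → Bool} (h : failures n ω < x) :
    steps x n ω = n :=
  steps_eq_self fun _ hk => (failures_mono ω hk.le).trans_lt h

/-- `alive` is nonincreasing in k, so the trials it selects form an initial segment. -/
lemma sum_alive_mul (x n : ℕ) (ω : ℕ → Bool) (h : ℕ → ℝ) :
    ∑ k ∈ Finset.range n, (alive x k ω : ℝ) * h k = ∑ k ∈ Finset.range (steps x n ω), h k := by
  induction n with
  | zero => simp [steps]
  | succ n ih =>
    rw [Finset.sum_range_succ, ih, steps_succ]
    by_cases hn : failures n ω < x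
    · simp [alive, hn, steps_eq_self_of_lt hn, Finset.sum_range_succ]
    · simp [alive, hn]

lemma failures_steps_le (x n : ℕ) (ω : ℕ → Bool) : failures (steps x n ω) ω ≤ x := by
  induction n with
  | zero => simp [steps, failures]
  | succ n ih =>
    rw [steps_succ]
    by_cases hn : failures n ω < x
    · simp only [alive, hn, steps_eq_self_of_lt hn, if_true, failures_succ]
      omega
    · simpa [alive, hn] using ih

lemma failures_congr {n k : ℕ} (hk : k ≤ n) {ω ω' : ℕ → Bool}
    (h : ∀ i ∈ (Finset.range n : Set ℕ), ω i = ω' i) : failures k ω = failures k ω' :=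
  Finset.sum_congr rfl fun i hi => by
    rw [h i (by simpa using (Finset.mem_range.1 hi).trans_le hk)]

lemma steps_congr (x : ℕ) {n : ℕ} {ω ω' : ℕ → Bool}
    (h : ∀ i ∈ (Finset.range n : Set ℕ), ω i = ω' i) : steps x n ω = steps x n ω' :=
  Finset.sum_congr rfl fun i hi => by
    rw [alive, alive, failures_congr (Finset.mem_range.1 hi).le h]

lemma steps_le (x n : ℕ) (ω : ℕ → Bool) : steps x n ω ≤ n := by
  induction n with
  | zero => simp [steps]
  | succ n ih => rw [steps_succ, alive]; split_ifs <;> omega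

lemma mart_congr (p : Env) {n k : ℕ} (hk : k ≤ n) {ω ω' : ℕ → Bool}
    (h : ∀ i ∈ (Finset.range n : Set ℕ), ω i = ω' i) : mart p k ω = mart p k ω' :=
  Finset.sum_congr rfl fun i hi => by
    rw [noise, noise, h i (by simpa using (Finset.mem_range.1 hi).trans_le hk)]

/-- The centred walk stopped at the `x`-th failure. -/
noncomputable def stopped (p : Env) (x n : ℕ) (ω : ℕ → Bool) : ℝ := mart p (steps x n ω) ω

lemma stopped_succ (p : Env) (x n : ℕ) (ω : ℕ → Bool) :
    stopped p x (n + 1) ω = stopped p x n ω + alive x n ω * noise p n ω := by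
  simp only [stopped, mart, ← sum_alive_mul, Finset.sum_range_succ]

lemma varSum_steps_succ (p : Env) (x n : ℕ) (ω : ℕ → Bool) :
    varSum p (steps x (n + 1) ω) =
      varSum p (steps x n ω) + alive x n ω * ((p n : ℝ) * (1 - p n)) := by
  simp only [varSum, ← sum_alive_mul, Finset.sum_range_succ]

lemma dependsOn_stopped (p : Env) (x n : ℕ) :
    DependsOn (stopped p x n) (Finset.range n) := fun ω ω' h => by
  rw [stopped, stopped, steps_congr x h, mart_congr p (steps_le x n ω') h]

lemma dependsOn_steps {β : Type*} (f : ℕ → β) (x n : ℕ) :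
    DependsOn (fun ω => f (steps x n ω)) (Finset.range n) := fun ω ω' h => by
  simp only [steps_congr x h]

lemma dependsOn_alive (x n : ℕ) :
    DependsOn (fun ω => (alive x n ω : ℝ)) (Finset.range n) := fun ω ω' h => by
  simp only [alive, failures_congr le_rfl h]

lemma dependsOn_comp₂ {n : ℕ} {Y Z : (ℕ → Bool) → ℝ} (hY : DependsOn Y (Finset.range n))
    (hZ : DependsOn Z (Finset.range n)) (f : ℝ → ℝ → ℝ) :
    DependsOn (fun ω => f (Y ω) (Z ω)) (Finset.range n) := fun ω ω' h => by
  simp only [hY h, hZ h]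

lemma dependsOn_range_succ {n : ℕ} {Y : (ℕ → Bool) → ℝ} (hY : DependsOn Y (Finset.range n)) :
    DependsOn Y (Finset.range (n + 1)) := fun ω ω' h =>
  hY fun i hi => h i (by simp at hi ⊢; omega)

lemma dependsOn_comp_eval (n : ℕ) (g : Bool → ℝ) :
    DependsOn (fun ω : ℕ → Bool => g (ω n)) (Finset.range (n + 1)) := fun ω ω' h => by
  simp only [h n (by simp)]

lemma integrable_mul_eval (p : Env) {n : ℕ} {Y : (ℕ → Bool) → ℝ}
    (hY : DependsOn Y (Finset.range n)) (g : Bool → ℝ) :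
    Integrable (fun ω => Y ω * g (ω n)) (trialLaw p) :=
  integrable_of_dependsOn p (dependsOn_comp₂ (dependsOn_range_succ hY)
    (dependsOn_comp_eval n g) (· * ·))

lemma integral_stopped (p : Env) (x n : ℕ) : ∫ ω, stopped p x n ω ∂(trialLaw p) = 0 := by
  induction n with
  | zero => simp [stopped, steps, mart]
  | succ n ih =>
    have ha := dependsOn_alive x n
    let g : Bool → ℝ := fun b => 2 * ((b.toNat : ℝ) - p n)
    have h1 := integral_mul_eval p ha g
    have hstep : ∀ ω, stopped p x (n + 1) ω = stopped p x n ω + alive x n ω * g (ω n) :=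
      stopped_succ p x n
    simp only [hstep]
    rw [integral_add (integrable_of_dependsOn p (dependsOn_stopped p x n))
      (integrable_mul_eval p ha g), ih, h1]
    simp only [g, Bool.toNat_true, Bool.toNat_false, Nat.cast_one, Nat.cast_zero]
    ring

/-- On squaring one more step, the cross term has mean zero because `noise` is centred and
independent of the past, while the squared increment has mean 4 p_n (1 - p_n). -/
lemma integral_stopped_sq (p : Env) (x n : ℕ) :
    ∫ ω, stopped p x n ω ^ 2 ∂(trialLaw p) =
      4 * ∫ ω, varSum p (steps x n ω) ∂(trialLaw p) := by
  induction n with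
  | zero => simp [stopped, steps, mart, varSum]
  | succ n ih =>
    have ha := dependsOn_alive x n
    have hs := dependsOn_stopped p x n
    have hsa : DependsOn (fun ω => stopped p x n ω * alive x n ω) (Finset.range n) :=
      dependsOn_comp₂ hs ha (· * ·)
    let g : Bool → ℝ := fun b => 2 * (2 * ((b.toNat : ℝ) - p n))
    let g' : Bool → ℝ := fun b => (2 * ((b.toNat : ℝ) - p n)) ^ 2
    have hexp : ∀ ω, stopped p x (n + 1) ω ^ 2 = stopped p x n ω ^ 2 +
        (stopped p x n ω * alive x n ω * g (ω n) + alive x n ω * g' (ω n)) := fun ω => by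
      have : (alive x n ω : ℝ) ^ 2 = alive x n ω := by rw [alive]; split_ifs <;> simp
      simp only [stopped_succ, g, g', noise]
      linear_combination (2 * (((ω n).toNat : ℝ) - p n)) ^ 2 * this
    have hadd : Integrable (fun ω => stopped p x n ω * alive x n ω * g (ω n) +
        alive x n ω * g' (ω n)) (trialLaw p) :=
      (integrable_mul_eval p hsa g).add (integrable_mul_eval p ha g')
    simp only [hexp, varSum_steps_succ]
    rw [integral_add (integrable_of_dependsOn p (dependsOn_comp₂ hs hs fun a _ => a ^ 2)) hadd,
      integral_add (integrable_mul_eval p hsa g) (integrable_mul_eval p ha g'),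
      integral_add (integrable_of_dependsOn p (dependsOn_steps (varSum p) x n))
        ((integrable_of_dependsOn p ha).mul_const _),
      integral_mul_eval p hsa, integral_mul_eval p ha, ih, integral_mul_const]
    simp only [g, g', Bool.toNat_true, Bool.toNat_false, Nat.cast_one, Nat.cast_zero]
    ring

end Stopping

end CookieEnv

namespace CookieEnv

/-! ### The time of the x-th failure -/

section HittingTime

/-- The index of the trial in which the `x`-th failure occurs, if there is one. -/
noncomputable def hit (x : ℕ) (ω : ℕ → Bool) : ℕ := sInf {k | failures k ω = x}

variable {x : ℕ} {ω : ℕ → Bool}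

lemma failures_hit (h : ∃ k, failures k ω = x) : failures (hit x ω) ω = x :=
  Nat.sInf_mem (s := {k | failures k ω = x}) h

lemma failures_lt_iff (h : ∃ k, failures k ω = x) (k : ℕ) :
    failures k ω < x ↔ k < hit x ω := by
  have hx := failures_hit h
  constructor
  · intro hk
    by_contra! hle
    have := failures_mono ω hle
    simp only [hx] at this
    omega
  · intro hk
    have hle : failures k ω ≤ failures (hit x ω) ω := failures_mono ω hk.le
    have hne : failures k ω ≠ x := Nat.notMem_of_lt_sInf (s := {k | failures k ω = x}) hk
    omega

lemma steps_of_hit_le (h : ∃ k, failures k ω = x) {n : ℕ} (hn : hit x ω ≤ n) :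
    steps x n ω = hit x ω := by
  induction n, hn using Nat.le_induction with
  | base => exact steps_eq_self fun k hk => (failures_lt_iff h k).2 hk
  | succ n hn ih =>
    rw [steps_succ, ih, alive, if_neg (by rw [failures_lt_iff h]; omega), add_zero]

lemma steps_mono (x : ℕ) (ω : ℕ → Bool) : Monotone (steps x · ω) :=
  monotone_nat_of_le_succ fun n => by simp [steps_succ]

lemma steps_le_hit (h : ∃ k, failures k ω = x) (n : ℕ) : steps x n ω ≤ hit x ω := by
  rw [← steps_of_hit_le h (le_max_left (hit x ω) n)]
  exact steps_mono x ω (le_max_right _ _)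

lemma eventually_steps_eq (h : ∃ k, failures k ω = x) :
    ∀ᶠ n in atTop, steps x n ω = hit x ω :=
  (eventually_ge_atTop _).mono fun _ hn => steps_of_hit_le h hn

/-- The failure count starts at 0 and rises by at most one per trial, so it cannot jump over x. -/
lemma failures_lt_of_forall_ne (h : ¬ ∃ k, failures k ω = x) (k : ℕ) : failures k ω < x := by
  push Not at h
  induction k with
  | zero => exact lt_of_le_of_ne (by simp [failures]) (h 0)
  | succ k ih =>
    have := h (k + 1)
    rw [failures_succ] at this ⊢
    omega

lemma failures_le (k : ℕ) (ω : ℕ → Bool) : failures k ω ≤ k := by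
  induction k with
  | zero => simp [failures]
  | succ k ih => rw [failures_succ]; omega

lemma U_eq_hit_sub (hx : x ≠ 0) (h : ∃ k, failures k ω = x) :
    U x ω = ((hit x ω - x : ℕ) : ℕ∞) := by
  rw [U, if_neg hx, ENat.natCast_sub]
  congr 1
  refine le_antisymm (iInf₂_le (f := fun (k : ℕ) (_ : failures k ω = x) => (k : ℕ∞)) _
    (failures_hit h)) (le_iInf₂ fun k hk => ?_)
  exact_mod_cast Nat.sInf_le (s := {k | failures k ω = x}) hk

lemma sqDev_eq_hit (hx : x ≠ 0) (h : ∃ k, failures k ω = x) :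
    sqDev x ω = ((hit x ω : ℝ) - 2 * x) ^ 2 := by
  have hle : x ≤ hit x ω := by
    conv_lhs => rw [← failures_hit h]
    exact failures_le _ _
  rw [sqDev, U_eq_hit_sub hx h, ENat.toNat_natCast, Nat.cast_sub hle]
  ring

end HittingTime

/-- Fatou's lemma applied to the norms. -/
lemma integrable_of_tendsto_of_integral_norm_le {Ω : Type*} [MeasurableSpace Ω] {μ : Measure Ω}
    {f : ℕ → Ω → ℝ} {F : Ω → ℝ} {c : ℝ} (hf : ∀ n, Integrable (f n) μ)
    (hc : ∀ n, ∫ ω, ‖f n ω‖ ∂μ ≤ c)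
    (hlim : ∀ᵐ ω ∂μ, Tendsto (fun n => f n ω) atTop (𝓝 (F ω))) : Integrable F μ := by
  refine ⟨aestronglyMeasurable_of_tendsto_ae atTop (fun n => (hf n).1) hlim, ?_⟩
  have h1 : ∫⁻ ω, ‖F ω‖ₑ ∂μ = ∫⁻ ω, liminf (fun n => ‖f n ω‖ₑ) atTop ∂μ :=
    lintegral_congr_ae (hlim.mono fun ω h => h.enorm.liminf_eq.symm)
  rw [HasFiniteIntegral, h1]
  refine (lintegral_liminf_le' fun n => (hf n).1.enorm).trans_lt ?_
  refine (liminf_le_of_frequently_le' (.of_forall fun n => ?_)).trans_lt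
    (ENNReal.ofReal_lt_top (r := c))
  rw [← ofReal_integral_norm_eq_lintegral_enorm (hf n)]
  exact ENNReal.ofReal_le_ofReal (hc n)

/-! ### First and second moments at the hitting time -/

section Moments

variable {p : Env} {A L K : ℝ}

lemma dependsOn_failures_steps (x n : ℕ) :
    DependsOn (fun ω => (failures (steps x n ω) ω : ℝ)) (Finset.range n) := fun ω ω' h => by
  simp only [steps_congr x h, failures_congr (steps_le x n ω') h]

lemma integral_steps (p : Env) (x n : ℕ) :
    ∫ ω, (steps x n ω : ℝ) ∂(trialLaw p) =
      2 * ∫ ω, (failures (steps x n ω) ω : ℝ) ∂(trialLaw p) +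
        ∫ ω, drift p (steps x n ω) ∂(trialLaw p) := by
  have h0 := integral_stopped p x n
  have hF := (integrable_of_dependsOn p (dependsOn_failures_steps x n)).const_mul 2
  have hN := integrable_of_dependsOn p (dependsOn_steps (fun k => (k : ℝ)) x n)
  have hD := integrable_of_dependsOn p (dependsOn_steps (drift p) x n)
  simp only [stopped, mart_eq] at h0
  rw [integral_sub (hN.sub' hF) hD, integral_sub hN hF, integral_const_mul] at h0
  linarith

lemma abs_integral_le_of_forall {f : (ℕ → Bool) → ℝ} {c : ℝ} (h : ∀ ω, |f ω| ≤ c) :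
    |∫ ω, f ω ∂(trialLaw p)| ≤ c := by
  simpa using norm_integral_le_of_norm_le_const (μ := trialLaw p) (f := f) (ae_of_all _ h)

lemma integral_steps_le (hL : ∀ n, |drift p n| ≤ L) (x n : ℕ) :
    ∫ ω, (steps x n ω : ℝ) ∂(trialLaw p) ≤ 2 * x + L := by
  have h1 := abs_integral_le_of_forall (p := p) (fun ω => hL (steps x n ω))
  have h2 : |∫ ω, (failures (steps x n ω) ω : ℝ) ∂(trialLaw p)| ≤ x :=
    abs_integral_le_of_forall fun ω => by
      rw [Nat.abs_cast]; exact_mod_cast failures_steps_le x n ω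
  rw [integral_steps]
  linarith [(abs_le.1 h1).2, (abs_le.1 h2).2]

/-- If the x-th failure never comes, the truncated time equals n. Markov's inequality and the bound
on its mean, uniform in n, then rule out positive probability. -/
lemma ae_exists_failures_eq (hL : ∀ n, |drift p n| ≤ L) (x : ℕ) :
    ∀ᵐ ω ∂(trialLaw p), ∃ k, failures k ω = x := by
  rw [ae_iff, ← measureReal_eq_zero_iff]
  set S := {ω : ℕ → Bool | ¬ ∃ k, failures k ω = x}
  have hb : ∀ n : ℕ, (trialLaw p).real S * n ≤ 2 * x + L := fun n => by
    have hN := integrable_of_dependsOn p (dependsOn_steps (fun k => (k : ℝ)) x n)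
    have hm := mul_meas_ge_le_integral_of_nonneg (μ := trialLaw p)
      (ae_of_all _ fun ω => Nat.cast_nonneg (steps x n ω)) hN (n : ℝ)
    have hsub : (trialLaw p).real S ≤ (trialLaw p).real {ω | (n : ℝ) ≤ steps x n ω} :=
      measureReal_mono fun ω hω => by
        simp [steps_eq_self fun k _ => failures_lt_of_forall_ne hω k]
    have := integral_steps_le hL x n
    nlinarith [(Nat.cast_nonneg n : (0 : ℝ) ≤ n)]
  by_contra hne
  have hpos : 0 < (trialLaw p).real S := lt_of_le_of_ne measureReal_nonneg (Ne.symm hne)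
  obtain ⟨n, hn⟩ := exists_nat_gt ((2 * x + L) / (trialLaw p).real S)
  rw [div_lt_iff₀ hpos] at hn
  linarith [hb n]

lemma tendsto_steps_comp (hL : ∀ n, |drift p n| ≤ L) (x : ℕ) (f : ℕ → (ℕ → Bool) → ℝ) :
    ∀ᵐ ω ∂(trialLaw p), Tendsto (fun n => f (steps x n ω) ω) atTop (𝓝 (f (hit x ω) ω)) :=
  (ae_exists_failures_eq hL x).mono fun ω h =>
    tendsto_const_nhds.congr' ((eventually_steps_eq h).mono fun n hn => by simp only [hn])

lemma abs_integral_stopped_sq_sub_le (hK : ∀ n, |varSum p n - n * A| ≤ K) (x n : ℕ) :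
    |∫ ω, stopped p x n ω ^ 2 ∂(trialLaw p) -
      4 * A * ∫ ω, (steps x n ω : ℝ) ∂(trialLaw p)| ≤ 4 * K := by
  have hN := integrable_of_dependsOn p (dependsOn_steps (fun k => (k : ℝ)) x n)
  have hV := integrable_of_dependsOn p (dependsOn_steps (varSum p) x n)
  have h := abs_integral_le_of_forall (p := p) (fun ω => hK (steps x n ω))
  rw [integral_sub hV (hN.mul_const A), integral_mul_const] at h
  rw [integral_stopped_sq, abs_le] at *
  constructor <;> linarith [h.1, h.2]

lemma integrable_mart_hit_sq (hA : 0 < A) (hL : ∀ n, |drift p n| ≤ L)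
    (hK : ∀ n, |varSum p n - n * A| ≤ K) (x : ℕ) :
    Integrable (fun ω => mart p (hit x ω) ω ^ 2) (trialLaw p) := by
  refine integrable_of_tendsto_of_integral_norm_le (f := fun n ω => stopped p x n ω ^ 2)
    (c := 4 * K + 4 * A * (2 * x + L))
    (fun n => integrable_of_dependsOn p (dependsOn_comp₂ (dependsOn_stopped p x n)
      (dependsOn_stopped p x n) fun a _ => a ^ 2)) (fun n => ?_)
    (tendsto_steps_comp hL x fun k ω => mart p k ω ^ 2)
  have h1 := (abs_le.1 (abs_integral_stopped_sq_sub_le hK x n)).2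
  have h2 := mul_le_mul_of_nonneg_left (integral_steps_le hL x n) (by positivity : 0 ≤ 4 * A)
  simp only [norm_pow, Real.norm_eq_abs, sq_abs]
  linarith

lemma aestronglyMeasurable_hit (hL : ∀ n, |drift p n| ≤ L) (x : ℕ) :
    AEStronglyMeasurable (fun ω => (hit x ω : ℝ)) (trialLaw p) :=
  aestronglyMeasurable_of_tendsto_ae atTop
    (fun n => (integrable_of_dependsOn p (dependsOn_steps (fun k => (k : ℝ)) x n)).1)
    (tendsto_steps_comp hL x fun k _ => (k : ℝ))

/-- Almost surely T + c is M_T plus a bounded term, so its square inherits integrability. These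
squares serve as dominating functions below. -/
lemma integrable_add_hit_sq (hA : 0 < A) (hL : ∀ n, |drift p n| ≤ L)
    (hK : ∀ n, |varSum p n - n * A| ≤ K) (x : ℕ) (c : ℝ) :
    Integrable (fun ω => ((hit x ω : ℝ) + c) ^ 2) (trialLaw p) := by
  have hL0 : 0 ≤ L := (abs_nonneg _).trans (hL 0)
  refine Integrable.mono' (((integrable_mart_hit_sq hA hL hK x).const_mul 2).add
    (integrable_const (2 * (2 * x + L + |c|) ^ 2)))
    (((aestronglyMeasurable_hit hL x).add_const c).pow 2) ?_
  filter_upwards [ae_exists_failures_eq hL x] with ω h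
  have hm := mart_eq p (hit x ω) ω
  rw [failures_hit h] at hm
  have hd := hL (hit x ω)
  have hb : ((2 * x + drift p (hit x ω) + c)) ^ 2 ≤ (2 * x + L + |c|) ^ 2 := by
    refine sq_le_sq' ?_ ?_ <;>
      linarith [abs_le.1 hd, (abs_le.1 hd).1, (abs_le.1 hd).2, neg_abs_le c, le_abs_self c,
        (Nat.cast_nonneg x : (0 : ℝ) ≤ x)]
  have he : (hit x ω : ℝ) + c =
      mart p (hit x ω) ω + (2 * x + drift p (hit x ω) + c) := by linarith
  rw [Real.norm_eq_abs, abs_of_nonneg (sq_nonneg _), he]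
  simp only [Pi.add_apply]
  nlinarith [sq_nonneg (mart p (hit x ω) ω - (2 * x + drift p (hit x ω) + c))]

lemma tendsto_integral_steps (hA : 0 < A) (hL : ∀ n, |drift p n| ≤ L)
    (hK : ∀ n, |varSum p n - n * A| ≤ K) (x : ℕ) :
    Tendsto (fun n => ∫ ω, (steps x n ω : ℝ) ∂(trialLaw p)) atTop
      (𝓝 (∫ ω, (hit x ω : ℝ) ∂(trialLaw p))) :=
  tendsto_integral_of_dominated_convergence (μ := trialLaw p)
    (F := fun n ω => (steps x n ω : ℝ)) (f := fun ω => (hit x ω : ℝ)) _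
    (fun n => (integrable_of_dependsOn p (dependsOn_steps (fun k => (k : ℝ)) x n)).1)
    -- The choice c = 1 works since T ≤ (T + 1)^2.
    (integrable_add_hit_sq hA hL hK x 1) (fun n => (ae_exists_failures_eq hL x).mono fun ω h => by
      have : (steps x n ω : ℝ) ≤ hit x ω := by exact_mod_cast steps_le_hit h n
      simp only [Real.norm_eq_abs, Nat.abs_cast]
      nlinarith [(Nat.cast_nonneg (hit x ω) : (0 : ℝ) ≤ hit x ω)])
    (tendsto_steps_comp hL x fun k _ => (k : ℝ))

lemma tendsto_integral_stopped_sq (hA : 0 < A) (hL : ∀ n, |drift p n| ≤ L)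
    (hK : ∀ n, |varSum p n - n * A| ≤ K) (x : ℕ) :
    Tendsto (fun n => ∫ ω, stopped p x n ω ^ 2 ∂(trialLaw p)) atTop
      (𝓝 (∫ ω, mart p (hit x ω) ω ^ 2 ∂(trialLaw p))) := by
  have hL0 : 0 ≤ L := (abs_nonneg _).trans (hL 0)
  exact tendsto_integral_of_dominated_convergence (μ := trialLaw p)
    (F := fun n ω => stopped p x n ω ^ 2) (f := fun ω => mart p (hit x ω) ω ^ 2) _
    (fun n => (integrable_of_dependsOn p (dependsOn_comp₂ (dependsOn_stopped p x n)
      (dependsOn_stopped p x n) fun a _ => a ^ 2)).1)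
    -- By `mart_eq`, the stopped walk is at most T + 2x + L in absolute value.
    (integrable_add_hit_sq hA hL hK x (2 * x + L))
    (fun n => (ae_exists_failures_eq hL x).mono fun ω h => by
      have h1 : (steps x n ω : ℝ) ≤ hit x ω := by exact_mod_cast steps_le_hit h n
      have h2 : (failures (steps x n ω) ω : ℝ) ≤ x := by exact_mod_cast failures_steps_le x n ω
      have h3 := abs_le.1 (hL (steps x n ω))
      have h4 : (0 : ℝ) ≤ steps x n ω := Nat.cast_nonneg _
      have h5 : (0 : ℝ) ≤ failures (steps x n ω) ω := Nat.cast_nonneg _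
      rw [Real.norm_eq_abs, abs_of_nonneg (sq_nonneg _), stopped, mart_eq]
      refine sq_le_sq' ?_ ?_ <;> linarith [h3.1, h3.2])
    (tendsto_steps_comp hL x fun k ω => mart p k ω ^ 2)

lemma tendsto_integral_failures_steps (hL : ∀ n, |drift p n| ≤ L) (x : ℕ) :
    Tendsto (fun n => ∫ ω, (failures (steps x n ω) ω : ℝ) ∂(trialLaw p)) atTop (𝓝 x) := by
  have hF := tendsto_integral_of_dominated_convergence (μ := trialLaw p)
    (F := fun n ω => (failures (steps x n ω) ω : ℝ))
    (f := fun ω => (failures (hit x ω) ω : ℝ)) (fun _ => (x : ℝ))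
    (fun n => (integrable_of_dependsOn p (dependsOn_failures_steps x n)).1)
    (integrable_const _) (fun n => ae_of_all _ fun ω => by
      simpa using failures_steps_le x n ω)
    (tendsto_steps_comp hL x fun k ω => (failures k ω : ℝ))
  have hFx : ∫ ω, (failures (hit x ω) ω : ℝ) ∂(trialLaw p) = x := by
    rw [integral_congr_ae (g := fun _ => (x : ℝ)) ((ae_exists_failures_eq hL x).mono fun ω h => by
      simp only [failures_hit h])]
    simp
  rwa [hFx] at hF

lemma abs_integral_mart_hit_sq_sub_le (hA : 0 < A) (hL : ∀ n, |drift p n| ≤ L)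
    (hK : ∀ n, |varSum p n - n * A| ≤ K) (x : ℕ) :
    |∫ ω, mart p (hit x ω) ω ^ 2 ∂(trialLaw p) - 8 * A * x| ≤ 4 * K + 4 * A * L := by
  have hN := tendsto_integral_steps hA hL hK x
  have hX := tendsto_integral_stopped_sq hA hL hK x
  have hF := tendsto_integral_failures_steps hL x
  have hT : |∫ ω, (hit x ω : ℝ) ∂(trialLaw p) - 2 * x| ≤ L := by
    refine le_of_tendsto (hN.sub (hF.const_mul 2)).abs (.of_forall fun n => ?_)
    rw [integral_steps, add_sub_cancel_left]
    exact abs_integral_le_of_forall fun ω => hL _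
  have hQ := le_of_tendsto (hX.sub (hN.const_mul (4 * A))).abs
    (.of_forall fun n => abs_integral_stopped_sq_sub_le hK x n)
  calc _ = |(∫ ω, mart p (hit x ω) ω ^ 2 ∂(trialLaw p) -
          4 * A * ∫ ω, (hit x ω : ℝ) ∂(trialLaw p)) +
          4 * A * (∫ ω, (hit x ω : ℝ) ∂(trialLaw p) - 2 * x)| := by congr 1; ring
    _ ≤ _ := abs_add_le _ _
    _ ≤ 4 * K + 4 * A * L := by
      rw [abs_mul, abs_of_pos (by positivity : 0 < 4 * A)]
      gcongr

lemma integrable_sqDev (hA : 0 < A) (hL : ∀ n, |drift p n| ≤ L)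
    (hK : ∀ n, |varSum p n - n * A| ≤ K) (x : ℕ) : Integrable (sqDev x) (trialLaw p) := by
  rcases eq_or_ne x 0 with rfl | hx
  · have : sqDev 0 = fun _ => 1 := by ext ω; simp [sqDev, U]
    rw [this]
    exact integrable_const _
  · refine (integrable_add_hit_sq hA hL hK x (-(2 * x))).congr
      ((ae_exists_failures_eq hL x).mono fun ω h => ?_)
    simp only [sqDev_eq_hit hx h, sub_eq_add_neg]

lemma ae_U_ne_top (hL : ∀ n, |drift p n| ≤ L) (x : ℕ) :
    ∀ᵐ ω ∂(trialLaw p), U x ω ≠ ⊤ := by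
  filter_upwards [ae_exists_failures_eq hL x] with ω h
  rcases eq_or_ne x 0 with rfl | hx
  · simp [U]
  · rw [U_eq_hit_sub hx h]
    exact ENat.natCast_ne_top _

/-- The cross term is controlled by 2|M_T| ≤ M_T^2/√x + √x. The weight √x balances the two terms,
since E M_T^2 is of order x. -/
lemma abs_integral_sqDev_sub_le (hA : 0 < A) (hL : ∀ n, |drift p n| ≤ L)
    (hK : ∀ n, |varSum p n - n * A| ≤ K) {x : ℕ} (hx : x ≠ 0) :
    |∫ ω, sqDev x ω ∂(trialLaw p) - ∫ ω, mart p (hit x ω) ω ^ 2 ∂(trialLaw p)| ≤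
      L * ((∫ ω, mart p (hit x ω) ω ^ 2 ∂(trialLaw p)) / √x + √x) + L ^ 2 := by
  have hL0 : 0 ≤ L := (abs_nonneg _).trans (hL 0)
  have hM := integrable_mart_hit_sq hA hL hK x
  have hs : 0 < √(x : ℝ) := Real.sqrt_pos.2 (by positivity)
  have hinner : Integrable (fun ω => mart p (hit x ω) ω ^ 2 / √x + √x) (trialLaw p) :=
    (hM.div_const _).add (integrable_const _)
  have hbound : Integrable (fun ω => L * (mart p (hit x ω) ω ^ 2 / √x + √x) + L ^ 2)
      (trialLaw p) :=
    (hinner.const_mul _).add (integrable_const _)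
  rw [← integral_sub (integrable_sqDev hA hL hK x) hM]
  refine (norm_integral_le_of_norm_le (f := fun ω => sqDev x ω - mart p (hit x ω) ω ^ 2)
    hbound ?_).trans_eq ?_
  · filter_upwards [ae_exists_failures_eq hL x] with ω h
    have hm := mart_eq p (hit x ω) ω
    rw [failures_hit h] at hm
    have hd := hL (hit x ω)
    rw [sqDev_eq_hit hx h, show (hit x ω : ℝ) - 2 * x = mart p (hit x ω) ω + drift p (hit x ω) by
      linarith]
    set X := mart p (hit x ω) ω
    set d := drift p (hit x ω)
    have hamgm : 2 * |X| ≤ X ^ 2 / √x + √x := by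
      rw [← sub_nonneg, show X ^ 2 / √(x : ℝ) + √x - 2 * |X| = (|X| - √x) ^ 2 / √x by
        field_simp
        rw [← sq_abs X]
        ring]
      positivity
    rw [Real.norm_eq_abs, show (X + d) ^ 2 - X ^ 2 = d * (2 * X) + d ^ 2 by ring]
    calc |d * (2 * X) + d ^ 2| ≤ |d * (2 * X)| + |d ^ 2| := abs_add_le _ _
      _ = |d| * (2 * |X|) + |d| ^ 2 := by simp [abs_mul, abs_pow]
      _ ≤ L * (X ^ 2 / √x + √x) + L ^ 2 := by gcongr
  · rw [integral_add (hinner.const_mul _) (integrable_const _), integral_const_mul,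
      integral_add (hM.div_const _) (integrable_const _),
      integral_div]
    simp

lemma abs_nu_sub_le (hA : 0 < A) (hL : ∀ n, |drift p n| ≤ L)
    (hK : ∀ n, |varSum p n - n * A| ≤ K) {x : ℕ} (hx : x ≠ 0) :
    |nu p x - 8 * A| ≤
      (4 * K + 4 * A * L + L * (8 * A + 4 * K + 4 * A * L + 1) + L ^ 2) / √x := by
  have hL0 : 0 ≤ L := (abs_nonneg _).trans (hL 0)
  have hK0 : 0 ≤ K := (abs_nonneg _).trans (hK 0)
  have h1 := abs_integral_mart_hit_sq_sub_le hA hL hK x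
  have h2 := abs_integral_sqDev_sub_le hA hL hK hx
  rw [nu]
  set E := ∫ ω, sqDev x ω ∂(trialLaw p)
  set Q := ∫ ω, mart p (hit x ω) ω ^ 2 ∂(trialLaw p)
  set c := 4 * K + 4 * A * L with hc
  have hc0 : 0 ≤ c := by positivity
  have hx1 : (1 : ℝ) ≤ x := by exact_mod_cast Nat.one_le_iff_ne_zero.2 hx
  obtain ⟨s, hs⟩ : ∃ s, s = √(x : ℝ) := ⟨_, rfl⟩
  have hss : s ^ 2 = x := by rw [hs, Real.sq_sqrt (by positivity)]
  have hs1 : 1 ≤ s := by rw [hs]; exact Real.one_le_sqrt.2 hx1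
  have hs0 : 0 < s := by linarith
  rw [← hs] at h2 ⊢
  rw [← hss] at h1 ⊢
  have hQ : Q / s ≤ 8 * A * s + c * s := by
    rw [div_le_iff₀ hs0]
    nlinarith [(abs_le.1 h1).2]
  have h3 : |E - 8 * A * s ^ 2| ≤ (c + L * (8 * A + c + 1) + L ^ 2) * s := by
    calc |E - 8 * A * s ^ 2| ≤ |E - Q| + |Q - 8 * A * s ^ 2| := abs_sub_le _ _ _
      _ ≤ (L * ((8 * A * s + c * s) + s) + L ^ 2) + c := by
        refine add_le_add (h2.trans ?_) h1
        gcongr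
      _ ≤ _ := by nlinarith [mul_nonneg hc0 (sub_nonneg.2 hs1),
          mul_nonneg (sq_nonneg L) (sub_nonneg.2 hs1)]
  have h4 : 1 / s ^ 2 * E - 8 * A = (E - 8 * A * s ^ 2) / s ^ 2 := by field_simp
  rw [h4, abs_div, abs_of_pos (by positivity : 0 < s ^ 2), div_le_div_iff₀ (by positivity) hs0]
  calc |E - 8 * A * s ^ 2| * s ≤ ((c + L * (8 * A + c + 1) + L ^ 2) * s) * s := by gcongr
    _ = _ := by rw [hc]; ring

/-! ### From rates for averages to bounds for sums -/

lemma abs_drift_le (h : ∀ n : ℕ, 1 ≤ n → |pBar p n - 1 / 2| ≤ K / n) (n : ℕ) :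
    |drift p n| ≤ 2 * K := by
  have hK0 : 0 ≤ K := by simpa using (abs_nonneg _).trans (h 1 le_rfl)
  rcases Nat.eq_zero_or_pos n with rfl | hn
  · simpa [drift] using hK0
  have hn' : (0 : ℝ) < n := by exact_mod_cast hn
  have he : drift p n = 2 * (n * (pBar p n - 1 / 2)) := by
    simp only [drift, pBar, Finset.sum_sub_distrib, ← Finset.mul_sum, Finset.sum_const,
      Finset.card_range, nsmul_eq_mul]
    field_simp
  have := (le_div_iff₀ hn').1 (h n hn)
  rw [he, abs_mul, abs_mul, abs_of_pos hn', abs_of_pos (two_pos : (0 : ℝ) < 2)]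
  linarith

lemma abs_varSum_sub_le (h : ∀ n : ℕ, 1 ≤ n → |avgVar p n - A| ≤ K / n) (n : ℕ) :
    |varSum p n - n * A| ≤ K := by
  have hK0 : 0 ≤ K := by simpa using (abs_nonneg _).trans (h 1 le_rfl)
  rcases Nat.eq_zero_or_pos n with rfl | hn
  · simpa [varSum] using hK0
  have hn' : (0 : ℝ) < n := by exact_mod_cast hn
  have he : varSum p n - n * A = n * (avgVar p n - A) := by
    simp only [varSum, avgVar]
    field_simp
  have := (le_div_iff₀ hn').1 (h n hn)
  rw [he, abs_mul, abs_of_pos hn']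
  linarith

end Moments

end CookieEnv

theorem mainTheorem4 (p : CookieEnv.Env) (A : ℝ)
    (hp : Tendsto (CookieEnv.pBar p) atTop (𝓝 (1 / 2)))
    (hA : Tendsto (CookieEnv.avgVar p) atTop (𝓝 A))
    (hApos : 0 < A)
    (hrate : ∃ K : ℝ, ∀ n : ℕ, 1 ≤ n →
      |CookieEnv.pBar p n - 1 / 2| ≤ K / (n : ℝ) ∧ |CookieEnv.avgVar p n - A| ≤ K / (n : ℝ)) :
    (∀ x : ℕ, (∀ᵐ ω ∂(CookieEnv.trialLaw p), CookieEnv.U x ω ≠ ⊤) ∧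
      Integrable (CookieEnv.sqDev x) (CookieEnv.trialLaw p)) ∧
    Tendsto (CookieEnv.nu p) atTop (𝓝 (8 * A)) ∧
    ∃ (C : ℝ) (x₀ : ℕ), ∀ x : ℕ, x₀ ≤ x →
      |CookieEnv.nu p x - 8 * A| ≤ C * (Real.log (x : ℝ) ^ 4 / Real.sqrt (x : ℝ)) := by
  obtain ⟨K, hK⟩ := hrate
  have hL := CookieEnv.abs_drift_le fun n hn => (hK n hn).1
  have hV := CookieEnv.abs_varSum_sub_le fun n hn => (hK n hn).2
  refine ⟨fun x => ⟨CookieEnv.ae_U_ne_top hL x, CookieEnv.integrable_sqDev hApos hL hV x⟩, ?_⟩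
  obtain ⟨C, hC⟩ : ∃ C : ℝ, ∀ x : ℕ, x ≠ 0 → |CookieEnv.nu p x - 8 * A| ≤ C / √x :=
    ⟨_, fun x hx => CookieEnv.abs_nu_sub_le hApos hL hV hx⟩
  constructor
  · rw [tendsto_iff_norm_sub_tendsto_zero]
    refine squeeze_zero' (.of_forall fun x => norm_nonneg _)
      ((eventually_ne_atTop 0).mono hC) ?_
    exact tendsto_const_nhds.div_atTop (Real.tendsto_sqrt_atTop.comp tendsto_natCast_atTop_atTop)
  -- Since e < 3, log x ≥ 1 from x = 3 on, so the factor log^4 x only weakens the bound C/√x.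
  · refine ⟨C, 3, fun x hx => ?_⟩
    have hC0 : 0 ≤ C := by simpa using (abs_nonneg _).trans (hC 1 one_ne_zero)
    have hlog : 1 ≤ Real.log x := by
      rw [Real.le_log_iff_exp_le (by positivity)]
      have : (3 : ℝ) ≤ x := by exact_mod_cast hx
      linarith [Real.exp_one_lt_d9]
    refine (hC x (by omega)).trans ?_
    rw [← mul_div_assoc]
    gcongr
    exact le_mul_of_one_le_right hC0 (one_le_pow₀ hlog)
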